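/- All groups are finite. A group is $p$-nilpotent ($p$ a prime) if it has a normal subgroup of order prime to $p$ and of index a power of $p$. For a group $G$, let $F(G)$ denote the Fitting subgroup, that is, the product of all nilpotent normal subgroups of $G$. A group is supersoluble if it has a finite series of normal subgroups of the whole group, from $1$ to the group, with cyclic factors; let $\mathfrak U$ be the class of supersoluble groups. A chief factor $H/K$ of $G$ is $\mathfrak U$-central if the semidirect product $[H/K](G/C_G(H/K))$, formed with the action induced by conjugation, belongs to $\mathfrak U$. The $\mathfrak U$-hypercenter $Z_\infty^{\mathfrak U}(G)$ is the product of all normal subgroups $N$ of $G$ such that every chief factor $H/K$ of $G$ with $H\le N$ is $\mathfrak U$-central. A subgroup $A$ of $G$ is $s$-permutable in $G$ if $AP=PA$ for every Sylow subgroup $P$ of $G$ (for every prime). For $A\le G$ let $A_G$ be the largest normal subgroup of $G$ contained in $A$. A subgroup $A$ of $G$ is $\mathfrak U_{\mathrm s}$-quasinormal in $G$ if there is a normal subgroup $T$ of $G$ such that $AT$ is $s$-permutable in $G$ and $(A\cap T)A_G/A_G\le Z_\infty^{\mathfrak U}(G/A_G)$. **Theorem.** Let $G$ be a finite group and let $p$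 be a prime divisor of $|G|$ with $\gcd(|G|,p-1)=1$. Then $G$ is $p$-nilpotent if and only if $G$ has a soluble normal subgroup $H$ such that $G/H$ is $p$-nilpotent and every maximal subgroup of every Sylow subgroup of $F(H)$ (for every prime) is $\mathfrak U_{\mathrm s}$-quasinormal in $G$. -/

import Mathlib

open scoped Pointwise

universe u

/-- A class of groups (in a fixed universe). All the classes used here are invariant under
isomorphism. -/
abbrev GroupClass : Type (u + 1) := (X : Type u) → [Group X] → Prop

/-- A group is supersoluble if it has a finite normal series, all of whose terms are normal in the
whole group, with cyclic factors. The factor `N (i + 1) / N i` is taken as a subgroup of the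
quotient by `N i`. -/
def IsSupersolubleGroup : GroupClass.{u} := fun X _ =>
  ∃ (n : ℕ) (N : ℕ → Subgroup X) (_ : ∀ i, (N i).Normal),
    N 0 = ⊥ ∧ N n = ⊤ ∧
      ∀ i < n, N i ≤ N (i + 1) ∧ IsCyclic ((N (i + 1)).map (QuotientGroup.mk' (N i)))

/-- A finite group is `p`-nilpotent if it has a normal `p`-complement (a normal Hall
`p'`-subgroup): a normal subgroup of order prime to `p` whose index is a power of `p`. -/
def IsPNilpotentGroup (p : ℕ) (X : Type u) [Group X] : Prop :=
  ∃ N : Subgroup X, N.Normal ∧ (Nat.card N).Coprime p ∧ ∃ k : ℕ, N.index = p ^ k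

section

variable {G : Type u} [Group G]

/-- `H / K` is a chief factor of `G`: both are normal in `G`, `K < H`, and no normal subgroup of
`G` lies strictly between them. -/
def IsChiefFactor (H K : Subgroup G) : Prop :=
  H.Normal ∧ K.Normal ∧ K < H ∧
    ∀ N : Subgroup G, N.Normal → K ≤ N → N ≤ H → N = K ∨ N = H

/-- The section `H / K`, as a subgroup of `G / K`. -/
abbrev sectionQuotient (H K : Subgroup G) [K.Normal] : Subgroup (G ⧸ K) :=
  H.map (QuotientGroup.mk' K)

instance sectionQuotient_normal (H K : Subgroup G) [hH : H.Normal] [K.Normal] :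
    (sectionQuotient H K).Normal :=
  hH.map _ (QuotientGroup.mk'_surjective K)

/-- The action of `G` by conjugation on the section `H / K`, for `H` and `K` normal in `G`. -/
def sectionConj (H K : Subgroup G) [H.Normal] [K.Normal] :
    G →* MulAut (sectionQuotient H K) :=
  MulAut.conjNormal.comp (QuotientGroup.mk' K)

/-- The centralizer `C_G(H / K)`: the kernel of the conjugation action of `G` on `H / K`. -/
abbrev sectionCentralizer (H K : Subgroup G) [H.Normal] [K.Normal] : Subgroup G :=
  (sectionConj H K).ker

/-- The semidirect product `[H / K](G / C_G(H / K))`, for the action induced by conjugation. -/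
abbrev sectionSemidirect (H K : Subgroup G) [H.Normal] [K.Normal] : Type u :=
  sectionQuotient H K ⋊[QuotientGroup.kerLift (sectionConj H K)] (G ⧸ sectionCentralizer H K)

/-- The section `H / K` is `𝔉`-central in `G`. -/
def IsCentralSection (𝔉 : GroupClass.{u}) (H K : Subgroup G) [H.Normal] [K.Normal] : Prop :=
  𝔉 (sectionSemidirect H K)

variable (G) in
/-- The `𝔉`-hypercenter of `G`: the product of all normal subgroups `N` of `G` such that every
chief factor `H / K` of `G` with `H ≤ N` is `𝔉`-central. -/
def hypercenterOf (𝔉 : GroupClass.{u}) : Subgroup G :=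
  sSup {N : Subgroup G | N.Normal ∧
    ∀ (H K : Subgroup G) [H.Normal] [K.Normal],
      IsChiefFactor H K → H ≤ N → IsCentralSection 𝔉 H K}

/-- `H` is `s`-permutable in `G`: `HP = PH` for every Sylow subgroup `P` of `G`. -/
def IsSPermutable (H : Subgroup G) : Prop :=
  ∀ (q : ℕ), q.Prime → ∀ P : Sylow q G, (H : Set G) * (P : Set G) = (P : Set G) * (H : Set G)

/-- `H` is `𝔉ₛ`-quasinormal in `G`: for some normal subgroup `T` of `G`, the product `HT` is
`s`-permutable in `G` and `(H ∩ T)H_G / H_G` lies in the `𝔉`-hypercenter of `G / H_G`, where `H_G`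
is the largest normal subgroup of `G` contained in `H`. -/
def IsSQuasinormalFor (𝔉 : GroupClass.{u}) (H : Subgroup G) : Prop :=
  ∃ T : Subgroup G, T.Normal ∧ IsSPermutable (H ⊔ T) ∧
    ((H ⊓ T) ⊔ H.normalCore).map (QuotientGroup.mk' H.normalCore) ≤
      hypercenterOf (G ⧸ H.normalCore) 𝔉

variable (G) in
/-- The Fitting subgroup: the product of all nilpotent normal subgroups. -/
def fittingSubgroup : Subgroup G :=
  sSup {N : Subgroup G | N.Normal ∧ Group.IsNilpotent N}

/-- The Fitting subgroup `F(H)` of a subgroup `H` of `G`, as a subgroup of `G`. -/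
def fittingOf (H : Subgroup G) : Subgroup G :=
  (fittingSubgroup H).map H.subtype

end

open scoped commutatorElement

/-! ### Coprime action, nilpotent normal subgroups and the Fitting subgroup. -/

section

variable {G : Type*} [Group G]

/-! The direction from `G` to `H` is met by `H = 1`. For the converse put `F = F(H)`; since `F` is
nilpotent, each Sylow `q`-subgroup `P` of `F` is normal in `G`.

The core is that every chief factor of `G` between `Φ(P)` and `P` has order `q`
(`IsChiefFactor.relIndex_prime_of_quasinormal`). It reduces to a factor `C/A` that is the only
minimal normal subgroup of `G/A` inside `P/A`. A Sylow `q`-subgroup of `G` normalizes some maximal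
subgroup `M₁ ≥ A` of `C`. If `M₁ ≠ A`, a maximal subgroup `M` of `P` meets `C` in `M₁`, and
quasinormality of `M` either makes `M₁` normal in `G`, which is impossible, or forces `C/A` into the
supersoluble hypercenter of `G/A`, whose minimal normal subgroups have prime order.

The automorphism group of a group of order `q` is abelian of order `q - 1`. Hence `G'` centralizes
these factors, and so does all of `G` when `|G|` is prime to `q - 1`. Coprime action lifts this to
`P` for elements of prime power order, the prime not being `q` (`commute_of_forall_quasinormal`).
Applied to `[G, H] ≤ G'`, it gives `[G, H] ≤ F` because `H` is soluble (`le_fittingOf_of_commute`),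
so `H/F` is central in `G/F`. By `IsPNilpotentGroup.of_quotient`, `p`-nilpotency passes from `G/H`
to `G/F`, and then to `G`, since the Sylow `p`-subgroup of `F` is centralized by the `p'`-elements
of `G`. -/

theorem Subgroup.mem_of_pow_mem_of_coprime (S : Subgroup G) {x : G} {a b : ℕ} (hab : a.Coprime b)
    (ha : x ^ a ∈ S) (hb : x ^ b ∈ S) : x ∈ S := by
  have h : x = (x ^ a) ^ (a.gcdA b) * (x ^ b) ^ (a.gcdB b) := by
    rw [← zpow_natCast x a, ← zpow_natCast x b, ← zpow_mul, ← zpow_mul, ← zpow_add,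
      ← Nat.gcd_eq_gcd_ab, hab.gcd_eq_one]
    simp
  rw [h]
  exact S.mul_mem (S.zpow_mem ha _) (S.zpow_mem hb _)

/-- A subgroup of a finite group containing the elements of prime power order of another one
contains it. -/
theorem Subgroup.le_of_forall_primePow [Finite G] {K S : Subgroup G}
    (h : ∀ r : ℕ, r.Prime → ∀ x ∈ K, (∃ k : ℕ, x ^ r ^ k = 1) → x ∈ S) : K ≤ S := by
  have key : ∀ n : ℕ, 0 < n → ∀ x ∈ K, x ^ n = 1 → x ∈ S := by
    intro n
    induction n using Nat.recOnPosPrimePosCoprime with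
    | prime_pow p n hp hn => exact fun _ x hx h1 => h p hp x hx ⟨n, h1⟩
    | zero => exact fun h0 => absurd h0 (lt_irrefl 0)
    | one => intro _ x _ h1; rw [pow_one] at h1; exact h1 ▸ S.one_mem
    | coprime a b ha hb hab iha ihb =>
      intro _ x hx h1
      refine S.mem_of_pow_mem_of_coprime hab (ihb (by omega) _ (K.pow_mem hx _) ?_)
        (iha (by omega) _ (K.pow_mem hx _) ?_)
      · rw [← pow_mul, h1]
      · rw [← pow_mul, mul_comm, h1]
  exact fun x hx => key _ (orderOf_pos x) x hx (pow_orderOf_eq_one x)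

theorem isPGroup_zpowers {r k : ℕ} {x : G} (h : x ^ r ^ k = 1) :
    IsPGroup r (Subgroup.zpowers x) := by
  rw [isPGroup_iff_pow_pow_eq_one]
  rintro ⟨y, hy⟩
  obtain ⟨n, rfl⟩ := Subgroup.mem_zpowers_iff.1 hy
  refine ⟨k, Subtype.ext ?_⟩
  change (x ^ n) ^ r ^ k = 1
  rw [← zpow_natCast, ← zpow_mul, mul_comm, zpow_mul, zpow_natCast, h, one_zpow]

theorem Subgroup.exists_pow_pow_eq_one {q : ℕ} {P : Subgroup G} (hP : IsPGroup q P) {x : G}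
    (hx : x ∈ P) : ∃ k : ℕ, x ^ q ^ k = 1 := by
  obtain ⟨k, hk⟩ := isPGroup_iff_pow_pow_eq_one.1 hP ⟨x, hx⟩
  exact ⟨k, by simpa using congrArg Subtype.val hk⟩

/-- Coprime action: an `r`-element that centralizes a coset of a normal `q`-subgroup modulo this
subgroup commutes with an element of the coset. -/
theorem exists_commute_of_commutator_mem [Finite G] {q r : ℕ} (hq : q.Prime) (hr : r.Prime)
    (hqr : r ≠ q) {B : Subgroup G} [B.Normal] (hB : IsPGroup q B) {x y : G} {k : ℕ}
    (hx : x ^ r ^ k = 1) (hxy : ⁅x, y⁆ ∈ B) : ∃ b ∈ B, Commute x (y * b) := by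
  have hcom : ∀ g ∈ Subgroup.zpowers x, Commute (g : G ⧸ B) (y : G ⧸ B) := by
    have h1 : Commute (x : G ⧸ B) (y : G ⧸ B) := by
      rw [← commutatorElement_eq_one_iff_commute]
      exact (QuotientGroup.eq_one_iff ⁅x, y⁆).2 hxy
    rintro _ ⟨n, rfl⟩
    exact h1.zpow_left n
  let α := {z : G // (z : G ⧸ B) = (y : G ⧸ B)}
  let : MulAction (Subgroup.zpowers x) α :=
    { smul := fun g z => ⟨g * z * (g : G)⁻¹, by
        rw [QuotientGroup.mk_mul, QuotientGroup.mk_mul, z.2, (hcom g g.2).eq,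
          QuotientGroup.mk_inv, mul_inv_cancel_right]⟩
      one_smul := fun z => Subtype.ext (by
        change ((1 : Subgroup.zpowers x) : G) * z * ((1 : Subgroup.zpowers x) : G)⁻¹ = z
        simp)
      mul_smul := fun g h z => Subtype.ext (by
        change ((g * h : Subgroup.zpowers x) : G) * z * ((g * h : Subgroup.zpowers x) : G)⁻¹ =
          g * (h * z * (h : G)⁻¹) * (g : G)⁻¹
        simp [mul_assoc]) }
  have hcard : Nat.card α = Nat.card B := by
    refine Nat.card_congr ⟨fun z => ⟨y⁻¹ * z, QuotientGroup.eq.1 z.2.symm⟩,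
      fun b => ⟨y * b, (QuotientGroup.eq.2 (by simp)).symm⟩, fun z => by simp, fun b => by simp⟩
  have := Fact.mk hq
  have := Fact.mk hr
  have hnd : ¬ r ∣ Nat.card α := by
    obtain ⟨n, hn⟩ := IsPGroup.iff_card.1 hB
    rw [hcard, hn]
    exact fun hd => hqr ((Nat.prime_dvd_prime_iff_eq hr hq).1 (hr.dvd_of_dvd_pow hd))
  -- The coset `yB` has `|B|` elements, a power of `q`, so the `r`-group generated by `x` fixes one
  -- of them under conjugation.
  obtain ⟨z, hz⟩ := (isPGroup_zpowers hx).nonempty_fixed_point_of_prime_not_dvd_card α hnd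
  have h2 : x * z * x⁻¹ = z := congrArg Subtype.val (hz ⟨x, Subgroup.mem_zpowers x⟩)
  refine ⟨y⁻¹ * z, QuotientGroup.eq.1 z.2.symm, ?_⟩
  rw [mul_inv_cancel_left]
  exact mul_inv_eq_iff_eq_mul.1 h2

/-- The coset `yB` contains some `yb` that commutes with `x`. Modulo `D`, the element `x` commutes
with `yb` and with `b`, hence with `y`. This is one step down a series on whose factors `x` acts
trivially. -/
theorem commutator_mem_of_series [Finite G] {q r : ℕ} (hq : q.Prime) (hr : r.Prime)
    (hqr : r ≠ q) {B D : Subgroup G} [B.Normal] [D.Normal] (hB : IsPGroup q B)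
    {x y : G} {k : ℕ} (hx : x ^ r ^ k = 1) (hxy : ⁅x, y⁆ ∈ B) (hxB : ∀ b ∈ B, ⁅x, b⁆ ∈ D) :
    ⁅x, y⁆ ∈ D := by
  obtain ⟨b, hb, hc⟩ := exists_commute_of_commutator_mem hq hr hqr hB hx hxy
  rw [← QuotientGroup.eq_one_iff]
  have e1 : Commute (x : G ⧸ D) ((y * b : G) : G ⧸ D) := by
    change (QuotientGroup.mk' D) x * (QuotientGroup.mk' D) (y * b) =
      (QuotientGroup.mk' D) (y * b) * (QuotientGroup.mk' D) x
    rw [← map_mul, hc.eq, map_mul]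
  have e2 : Commute (x : G ⧸ D) (b : G ⧸ D) := by
    rw [← commutatorElement_eq_one_iff_commute]
    exact (QuotientGroup.eq_one_iff ⁅x, b⁆).2 (hxB b hb)
  have e3 := e1.mul_right e2.inv_right
  rw [QuotientGroup.mk_mul, mul_inv_cancel_right] at e3
  exact commutatorElement_eq_one_iff_commute.2 e3

/-- An element of prime power order lies in every normal `q`-subgroup of index prime to `q`. -/
theorem Subgroup.mem_of_pow_pow_eq_one {q k : ℕ} (hq : q.Prime) {N Q : Subgroup G} [Q.Normal]
    (hnd : ¬ q ∣ Q.relIndex N) {x : G} (hx : x ∈ N) (h : x ^ q ^ k = 1) : x ∈ Q := by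
  have h1 : x ^ Q.relIndex N ∈ Q := by
    have := (Q.subgroupOf N).pow_index_mem ⟨x, hx⟩
    rwa [Subgroup.mem_subgroupOf] at this
  exact Q.mem_of_pow_mem_of_coprime
    (((Nat.Prime.coprime_iff_not_dvd hq).2 hnd).symm.pow_right k) h1 (h ▸ Q.one_mem)

/-- A nilpotent normal subgroup of a finite group has Sylow subgroups normal in the group. -/
theorem Subgroup.exists_normal_sylow [Finite G] {q : ℕ} (hq : q.Prime) {N : Subgroup G} [N.Normal]
    (hN : Group.IsNilpotent N) (P : Sylow q N) :
    ((P : Subgroup N).map N.subtype).Normal ∧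
      IsPGroup q ((P : Subgroup N).map N.subtype) ∧
      ¬ q ∣ ((P : Subgroup N).map N.subtype).relIndex N := by
  have := Fact.mk hq
  have : (P : Subgroup N).Normal := inferInstance
  have := P.characteristic_of_normal this
  refine ⟨inferInstance, P.2.map _, ?_⟩
  have h := P.not_dvd_index
  rwa [← Subgroup.comap_map_eq_self_of_injective N.subtype_injective (P : Subgroup N),
    Subgroup.index_comap, N.range_subtype] at h

theorem isNilpotent_of_exists_normal_sylow [Finite G] {N : Subgroup G}
    (h : ∀ q : ℕ, q.Prime → ∃ Q ≤ N, Q.Normal ∧ IsPGroup q Q ∧ ¬ q ∣ Q.relIndex N) :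
    Group.IsNilpotent N := by
  refine ((Group.isNilpotent_of_finite_tfae (G := N)).out 0 3).2 ?_
  intro q hq P
  obtain ⟨Q, hQN, hQ, hQp, hQi⟩ := h q hq.out
  have : (P : Subgroup N) = Q.subgroupOf N := by
    apply le_antisymm
    · intro x hx
      obtain ⟨k, hk⟩ := Subgroup.exists_pow_pow_eq_one P.2 hx
      exact Subgroup.mem_of_pow_pow_eq_one hq.out hQi x.2 (by simpa using congrArg Subtype.val hk)
    · exact (hQp.comap_subtype).le_sylow_of_normal P
  rw [this]
  infer_instance

/-- Fitting's theorem, for finite groups. -/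
theorem isNilpotent_sup [Finite G] {A B : Subgroup G} [A.Normal] [B.Normal]
    (hA : Group.IsNilpotent A) (hB : Group.IsNilpotent B) :
    Group.IsNilpotent (A ⊔ B : Subgroup G) := by
  apply isNilpotent_of_exists_normal_sylow
  intro q hq
  obtain ⟨PA⟩ : Nonempty (Sylow q A) := inferInstance
  obtain ⟨PB⟩ : Nonempty (Sylow q B) := inferInstance
  obtain ⟨nA, pA, iA⟩ := Subgroup.exists_normal_sylow hq hA PA
  obtain ⟨nB, pB, iB⟩ := Subgroup.exists_normal_sylow hq hB PB
  have lA := Subgroup.map_subtype_le (PA : Subgroup A)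
  have lB := Subgroup.map_subtype_le (PB : Subgroup B)
  generalize (PA : Subgroup A).map A.subtype = QA at *
  generalize (PB : Subgroup B).map B.subtype = QB at *
  refine ⟨QA ⊔ QB, sup_le_sup lA lB, inferInstance, pA.to_sup_of_normal_right pB, ?_⟩
  -- The index of `QA QB` in `AB` is split at `A QA QB`. The two factors divide the indices of `QB`
  -- in `B` and of `QA` in `A`, both prime to `q`.
  have e : A ⊔ B = B ⊔ (A ⊔ (QA ⊔ QB)) := by
    apply le_antisymm
    · exact sup_le (le_sup_of_le_right le_sup_left) le_sup_left
    · exact sup_le le_sup_right (sup_le le_sup_left (sup_le_sup lA lB))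
  rw [← Subgroup.relIndex_mul_relIndex (QA ⊔ QB) (A ⊔ (QA ⊔ QB)) (A ⊔ B) le_sup_right
    (e ▸ le_sup_right), Subgroup.relIndex_sup_right, e, Subgroup.relIndex_sup_right,
    hq.dvd_mul]
  rintro (h | h)
  · exact iA (h.trans (Subgroup.relIndex_dvd_of_le_left _ le_sup_left))
  · exact iB (h.trans (Subgroup.relIndex_dvd_of_le_left _ (le_sup_of_le_right le_sup_right)))

theorem isNilpotent_fittingSubgroup [Finite G] : Group.IsNilpotent (fittingSubgroup G) := by
  obtain ⟨F, ⟨hF1, hF2⟩, hmax⟩ :=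
    (Set.toFinite {N : Subgroup G | N.Normal ∧ Group.IsNilpotent N}).exists_maximal
      ⟨⊥, inferInstance, inferInstance⟩
  have : fittingSubgroup G = F := by
    apply le_antisymm
    · refine sSup_le ?_
      rintro N ⟨hN1, hN2⟩
      exact le_sup_right.trans (hmax ⟨inferInstance, isNilpotent_sup hF2 hN2⟩ le_sup_left)
    · exact le_sSup ⟨hF1, hF2⟩
  rwa [this]

instance fittingSubgroup_characteristic : (fittingSubgroup G).Characteristic := by
  rw [Subgroup.characteristic_iff_map_le]
  intro e
  rw [fittingSubgroup, (Subgroup.gc_map_comap e.toMonoidHom).l_sSup]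
  refine iSup₂_le ?_
  rintro N ⟨hN, hN2⟩
  refine le_sSup ⟨hN.map _ e.surjective, ?_⟩
  exact (Group.isNilpotent_congr (e.subgroupMap N)).1 hN2

instance fittingOf_normal (H : Subgroup G) [H.Normal] : (fittingOf H).Normal :=
  ConjAct.normal_of_characteristic_of_normal

theorem fittingOf_le (H : Subgroup G) : fittingOf H ≤ H := Subgroup.map_subtype_le _

theorem isNilpotent_fittingOf [Finite G] (H : Subgroup G) : Group.IsNilpotent (fittingOf H) :=
  (Group.isNilpotent_congr
    ((fittingSubgroup H).equivMapOfInjective _ H.subtype_injective)).1 isNilpotent_fittingSubgroup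

theorem le_fittingOf {H E : Subgroup G} [hE : E.Normal] (hEH : E ≤ H)
    (hn : Group.IsNilpotent E) : E ≤ fittingOf H := by
  have h1 : E.subgroupOf H ≤ fittingSubgroup H :=
    le_sSup ⟨inferInstance, (Group.isNilpotent_congr (Subgroup.subgroupOfEquivOfLe hEH)).2 hn⟩
  have := Subgroup.map_mono (f := H.subtype) h1
  rwa [Subgroup.subgroupOf_map_subtype, inf_of_le_left hEH] at this

/-- `E'` normalizes each Sylow `q`-subgroup `R` of `E`: its `q`-elements lie in a normal
`q`-subgroup of `E`, hence in `R`, and its other elements of prime power order lie in `F` and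
commute with `R`. As `RE'` is normal in `E` and normalizes `R`, the Frattini argument makes `R`
normal in `E`. -/
theorem isNilpotent_of_commutator_le_nilpotent [Finite G] {E F : Subgroup G} [E.Normal] [F.Normal]
    (hF : Group.IsNilpotent F) (hEF : ⁅E, E⁆ ≤ F)
    (hcom : ∀ q r : ℕ, q.Prime → r.Prime → r ≠ q → ∀ x ∈ E, (∃ k : ℕ, x ^ r ^ k = 1) →
      ∀ y ∈ F, (∃ k : ℕ, y ^ q ^ k = 1) → Commute x y) :
    Group.IsNilpotent E := by
  refine ((Group.isNilpotent_of_finite_tfae (G := E)).out 0 3).2 ?_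
  intro q hq R
  have h1 : commutator E ≤ Subgroup.normalizer (R : Set E) := by
    apply Subgroup.le_of_forall_primePow
    rintro r hr x hx ⟨k, hk⟩
    have hxF : (x : G) ∈ F := by
      refine hEF ?_
      have := Subgroup.mem_map_of_mem E.subtype hx
      rwa [commutator_def, Subgroup.map_commutator, ← MonoidHom.range_eq_map,
        E.range_subtype] at this
    have hk' : (x : G) ^ r ^ k = 1 := by simpa using congrArg Subtype.val hk
    by_cases hrq : r = q
    · subst hrq
      obtain ⟨P⟩ : Nonempty (Sylow r F) := inferInstance
      obtain ⟨nP, pP, iP⟩ := Subgroup.exists_normal_sylow hr hF P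
      have h2 := (pP.comap_subtype (K := E)).le_sylow_of_normal R
      exact Subgroup.le_normalizer (h2 (Subgroup.mem_of_pow_pow_eq_one hr iP hxF hk'))
    · have hc : ∀ y ∈ (R : Subgroup E), y * x = x * y := by
        intro y hy
        obtain ⟨l, hl⟩ := Subgroup.exists_pow_pow_eq_one R.2 hy
        exact Subtype.ext (hcom r q hr hq.out (Ne.symm hrq) y y.2
          ⟨l, by simpa using congrArg Subtype.val hl⟩ x hxF ⟨k, hk'⟩)
      exact Subgroup.centralizer_le_normalizer _ (Subgroup.mem_centralizer_iff.2 hc)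
  have : ((R : Subgroup E) ⊔ commutator E).Normal := Subgroup.Normal.of_commutator_le E le_sup_right
  have h3 := Sylow.normalizer_sup_eq_top' R (N := (R : Subgroup E) ⊔ commutator E) le_sup_left
  have h4 : (R : Subgroup E) ⊔ commutator E ≤ Subgroup.normalizer (R : Set E) :=
    sup_le (Subgroup.le_normalizer (H := (R : Subgroup E))) h1
  rw [sup_eq_left.2 h4] at h3
  exact Subgroup.normalizer_eq_top_iff.1 h3

theorem commutator_self_lt {E : Subgroup G} (hs : Group.IsSolvable E) (hne : E ≠ ⊥) :
    ⁅E, E⁆ < E := by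
  have : Nontrivial E := (Subgroup.nontrivial_iff_ne_bot E).2 hne
  have h := Group.IsSolvable.commutator_lt_top_of_nontrivial E
  have h2 := (Subgroup.map_lt_map_iff_of_injective E.subtype_injective).2 h
  rwa [commutator_def, Subgroup.map_commutator, ← MonoidHom.range_eq_map, E.range_subtype] at h2

/-- A normal subgroup `E` of `G` in a soluble normal subgroup `H` lies in the Fitting subgroup of
`H` if its elements of prime power order centralize the Sylow subgroups of `F(H)` for the other
primes. -/
theorem le_fittingOf_of_commute [Finite G] {H : Subgroup G} [H.Normal] (hs : Group.IsSolvable H)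
    (E : Subgroup G) (hE : E.Normal) (hEH : E ≤ H)
    (hcom : ∀ q r : ℕ, q.Prime → r.Prime → r ≠ q → ∀ x ∈ E, (∃ k : ℕ, x ^ r ^ k = 1) →
      ∀ y ∈ fittingOf H, (∃ k : ℕ, y ^ q ^ k = 1) → Commute x y) :
    E ≤ fittingOf H := by
  induction E using WellFoundedLT.induction with
  | ind E ih =>
    by_cases hne : E = ⊥
    · rw [hne]; exact bot_le
    have hsE : Group.IsSolvable E :=
      Group.isSolvable_of_isSolvable_injective (Subgroup.inclusion_injective hEH)
    have hlt := commutator_self_lt hsE hne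
    -- Solubility makes `E'` smaller than `E`, so by induction `E'` lies in `F(H)`, and the previous
    -- criterion then makes `E` nilpotent.
    have hle := ih ⁅E, E⁆ hlt inferInstance (hlt.le.trans hEH)
      (fun q r hq hr hqr x hx => hcom q r hq hr hqr x (hlt.le hx))
    exact le_fittingOf hEH (isNilpotent_of_commutator_le_nilpotent (isNilpotent_fittingOf H) hle hcom)

end

/-! ### Finite `q`-groups: Frattini subgroup, maximal subgroups and central elements. -/

section

variable {X : Type*} [Group X]

theorem Subgroup.covBy_sup_zpowers [Finite X] {q : ℕ} (hq : q.Prime) {M : Subgroup X} [M.Normal]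
    {c : X} (hc : c ∉ M) (hcq : c ^ q ∈ M) : M ⋖ M ⊔ Subgroup.zpowers c := by
  refine ⟨left_lt_sup.2 fun h => hc (h (Subgroup.mem_zpowers c)), fun N hMN hN => ?_⟩
  obtain ⟨n, hnN, hnM⟩ := SetLike.exists_of_lt hMN
  obtain ⟨m, hm, z, hz, rfl⟩ := Subgroup.mem_sup_of_normal_left.1 (hN.le hnN)
  obtain ⟨k, rfl⟩ := mem_powers_iff_mem_zpowers.2 hz
  change m * c ^ k ∈ N at hnN
  change m * c ^ k ∉ M at hnM
  have h1 : c ^ k ∈ N := (N.mul_mem_cancel_left (hMN.le hm)).1 hnN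
  have h2 : c ^ k ∉ M := fun h => hnM (M.mul_mem hm h)
  have h3 : Nat.Coprime k q := by
    refine ((Nat.Prime.coprime_iff_not_dvd hq).2 ?_).symm
    rintro ⟨j, rfl⟩
    rw [pow_mul] at h2
    exact h2 (M.pow_mem hcq j)
  have h4 := N.mem_of_pow_mem_of_coprime h3 h1 (hMN.le hcq)
  exact hN.not_ge (sup_le hMN.le (Subgroup.zpowers_le.2 h4))

theorem Subgroup.exists_pow_notMem_of_isPGroup {q : ℕ} (hX : IsPGroup q X) {M : Subgroup X}
    {c : X} (hc : c ∉ M) : ∃ j : ℕ, c ^ j ∉ M ∧ (c ^ j) ^ q ∈ M := by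
  classical
  have hex : ∃ k : ℕ, c ^ q ^ k ∈ M := by
    obtain ⟨k, hk⟩ := isPGroup_iff_pow_pow_eq_one.1 hX c
    exact ⟨k, hk ▸ M.one_mem⟩
  obtain ⟨k, hk⟩ : ∃ k, Nat.find hex = k + 1 := by
    refine Nat.exists_eq_succ_of_ne_zero fun h => hc ?_
    have := Nat.find_spec hex
    rwa [h, pow_zero, pow_one] at this
  refine ⟨q ^ k, Nat.find_min hex (by omega), ?_⟩
  rw [← pow_mul, ← pow_succ, ← hk]
  exact Nat.find_spec hex

variable [Finite X] {q : ℕ}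

theorem IsPGroup.normal_of_isCoatom (hq : q.Prime) (hX : IsPGroup q X) {K : Subgroup X}
    (hK : IsCoatom K) : K.Normal := by
  have := Fact.mk hq
  have := hX.isNilpotent
  exact Subgroup.NormalizerCondition.normal_of_coatom K Group.normalizerCondition_of_isNilpotent hK

/-- If a maximal subgroup `K`, which is normal, misses `x ^ q`, then `x` lies in `K⟨x ^ q⟩`, so `x ^
(1 - q * j)` is in `K` for some `j`. The exponent is prime to the order of `x`, so `x` itself is in
`K`. -/
theorem IsPGroup.pow_mem_frattini (hq : q.Prime) (hX : IsPGroup q X) (x : X) :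
    x ^ q ∈ frattini X := by
  rw [frattini, Order.radical, Subgroup.mem_iInf]
  intro K
  rw [Subgroup.mem_iInf]
  intro hK
  have hK : IsCoatom K := hK
  have := hX.normal_of_isCoatom hq hK
  by_contra h
  have h1 : K ⊔ Subgroup.zpowers (x ^ q) = ⊤ :=
    hK.2 _ (left_lt_sup.2 fun h' => h (h' (Subgroup.mem_zpowers _)))
  obtain ⟨m, hm, z, hz, hmz⟩ := Subgroup.mem_sup_of_normal_left.1 (h1 ▸ Subgroup.mem_top x)
  obtain ⟨j, rfl⟩ := Subgroup.mem_zpowers_iff.1 hz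
  obtain ⟨k, hk⟩ := isPGroup_iff_pow_pow_eq_one.1 hX x
  have h2 : x ^ (1 - q * j : ℤ) ∈ K := by
    have : x ^ (1 - q * j : ℤ) = m := by
      rw [zpow_sub, zpow_one, zpow_mul, zpow_natCast]
      exact mul_inv_eq_iff_eq_mul.2 hmz.symm
    rwa [this]
  have h3 : IsCoprime (1 - q * j : ℤ) ((q : ℤ) ^ k) := by
    apply IsCoprime.pow_right
    exact ⟨1, j, by ring⟩
  obtain ⟨a, b, hab⟩ := h3
  have hx : x ∈ K := by
    have e : x = (x ^ (1 - q * j : ℤ)) ^ a * (x ^ q ^ k) ^ b := by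
      rw [← zpow_natCast x (q ^ k), ← zpow_mul, ← zpow_mul, ← zpow_add]
      push_cast
      rw [mul_comm _ a, mul_comm _ b, hab, zpow_one]
    rw [e, hk, one_zpow, mul_one]
    exact K.zpow_mem h2 a
  exact h (K.pow_mem hx q)

/-- The quotient by a maximal subgroup is cyclic, hence abelian. -/
theorem IsPGroup.commutator_le_frattini (hq : q.Prime) (hX : IsPGroup q X) :
    commutator X ≤ frattini X := by
  refine le_iInf₂ fun K hK => ?_
  have hK : IsCoatom K := hK
  have := hX.normal_of_isCoatom hq hK
  obtain ⟨c, -, hc⟩ := SetLike.exists_of_lt hK.lt_top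
  have h1 : K ⊔ Subgroup.zpowers c = ⊤ :=
    hK.2 _ (left_lt_sup.2 fun h' => hc (h' (Subgroup.mem_zpowers _)))
  have h2 : ∀ x : X, ∃ j : ℤ, (x : X ⧸ K) = (c : X ⧸ K) ^ j := by
    intro x
    obtain ⟨m, hm, z, hz, rfl⟩ := Subgroup.mem_sup_of_normal_left.1 (h1 ▸ Subgroup.mem_top x)
    obtain ⟨j, rfl⟩ := Subgroup.mem_zpowers_iff.1 hz
    refine ⟨j, ?_⟩
    rw [QuotientGroup.mk_mul, (QuotientGroup.eq_one_iff m).2 hm, one_mul, QuotientGroup.mk_zpow]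
  rw [commutator_def, Subgroup.commutator_le]
  intro x _ y _
  obtain ⟨i, hi⟩ := h2 x
  obtain ⟨j, hj⟩ := h2 y
  rw [← QuotientGroup.eq_one_iff]
  change ⁅(x : X ⧸ K), (y : X ⧸ K)⁆ = 1
  rw [hi, hj, commutatorElement_eq_one_iff_commute]
  exact Commute.zpow_zpow_self _ _ _

/-- In a finite `q`-group, every subgroup containing the Frattini subgroup is an intersection of
maximal subgroups. -/
theorem IsPGroup.exists_isCoatom_of_frattini_le (hq : q.Prime) (hX : IsPGroup q X)
    {S : Subgroup X} (hS : frattini X ≤ S) {x : X} (hx : x ∉ S) :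
    ∃ M : Subgroup X, IsCoatom M ∧ S ≤ M ∧ x ∉ M := by
  obtain ⟨M, hSM, ⟨-, hxM⟩, hmax⟩ :=
    (Set.toFinite {M : Subgroup X | S ≤ M ∧ x ∉ M}).exists_le_maximal ⟨le_rfl, hx⟩
  have : M.Normal :=
    Subgroup.Normal.of_commutator_le X ((hX.commutator_le_frattini hq).trans (hS.trans hSM))
  have hmem : ∀ N : Subgroup X, M < N → x ∈ N := by
    intro N hN
    by_contra h
    exact hN.not_ge (hmax ⟨hSM.trans hN.le, h⟩ hN.le)
  refine ⟨M, ⟨fun h => hxM (h ▸ Subgroup.mem_top x), fun N hN => ?_⟩, hSM, hxM⟩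
  rw [eq_top_iff]
  rintro y -
  by_cases hy : y ∈ M
  · exact hN.le hy
  -- Every subgroup properly above `M` contains `x`. As `M⟨y⟩` covers `M`, it equals `M⟨x⟩`, so `y`
  -- lies in every such subgroup.
  have h1 := Subgroup.covBy_sup_zpowers hq hy (hS.trans hSM (hX.pow_mem_frattini hq y))
  have h2 := hmem _ h1.lt
  have h3 : M < M ⊔ Subgroup.zpowers x := left_lt_sup.2 fun h => hxM (h (Subgroup.mem_zpowers x))
  have h4 : M ⊔ Subgroup.zpowers x = M ⊔ Subgroup.zpowers y :=
    (h1.eq_or_eq h3.le (sup_le le_sup_left (Subgroup.zpowers_le.2 h2))).resolve_left h3.ne'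
  have h5 : y ∈ M ⊔ Subgroup.zpowers x := h4 ▸ Subgroup.mem_sup_right (Subgroup.mem_zpowers y)
  exact sup_le hN.le (Subgroup.zpowers_le.2 (hmem N hN)) h5

/-- Conjugation by `X` on `C` fixes `1`, and the number of fixed points is divisible by `q`, so
there is another one. -/
theorem IsPGroup.exists_mem_center_of_normal (hq : q.Prime) (hX : IsPGroup q X) {C : Subgroup X}
    [C.Normal] (hC : C ≠ ⊥) : ∃ z ∈ C, z ≠ 1 ∧ z ∈ Subgroup.center X := by
  have := Fact.mk hq
  have hX' : IsPGroup q (ConjAct X) := hX.of_equiv ConjAct.toConjAct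
  have : Nontrivial C := (Subgroup.nontrivial_iff_ne_bot C).2 hC
  have hdvd : q ∣ Nat.card C :=
    (hX.to_subgroup C).card_eq_or_dvd.resolve_left Finite.one_lt_card.ne'
  have h1 : (1 : C) ∈ MulAction.fixedPoints (ConjAct X) C := fun g => smul_one g
  obtain ⟨b, hb, hne⟩ := hX'.exists_fixed_point_of_prime_dvd_card_of_fixed_point C hdvd h1
  refine ⟨b, b.2, fun h => hne (Subtype.ext h.symm), Subgroup.mem_center_iff.2 fun g => ?_⟩
  have := congrArg Subtype.val (hb (ConjAct.toConjAct g))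
  exact mul_inv_eq_iff_eq_mul.1 this

/-- In a finite `q`-group, below a normal subgroup `C` and above a smaller normal subgroup there is
a normal subgroup which is maximal in `C`. -/
theorem IsPGroup.exists_normal_covBy (hq : q.Prime) (hX : IsPGroup q X) {A C : Subgroup X}
    [hA : A.Normal] [C.Normal] (hAC : A < C) : ∃ M : Subgroup X, M.Normal ∧ A ≤ M ∧ M ⋖ C := by
  obtain ⟨M, hAM, ⟨hM, hMC⟩, hmax⟩ :=
    (Set.toFinite {M : Subgroup X | M.Normal ∧ M < C}).exists_le_maximal ⟨hA, hAC⟩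
  refine ⟨M, hM, hAM, ?_⟩
  have hker : (QuotientGroup.mk' M).ker = M := QuotientGroup.ker_mk' M
  have hne : C.map (QuotientGroup.mk' M) ≠ ⊥ := by
    rw [Ne, Subgroup.map_eq_bot_iff, hker]
    exact hMC.not_ge
  have : (C.map (QuotientGroup.mk' M)).Normal :=
    Subgroup.Normal.map inferInstance _ (QuotientGroup.mk'_surjective M)
  obtain ⟨_, ⟨c₀, hc₀, rfl⟩, h1, hcen⟩ := (hX.to_quotient M).exists_mem_center_of_normal hq hne
  have hc₀M : c₀ ∉ M := fun h => h1 ((QuotientGroup.eq_one_iff c₀).2 h)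
  -- A power of `c₀` has order `q` modulo `M` and is still central there. Adjoining it to `M` gives
  -- a normal subgroup covering `M`, which must be `C` by the maximality of `M`.
  obtain ⟨j, hj1, hj2⟩ := Subgroup.exists_pow_notMem_of_isPGroup hX hc₀M
  have hcen' : QuotientGroup.mk' M (c₀ ^ j) ∈ Subgroup.center (X ⧸ M) := by
    rw [map_pow]
    exact Subgroup.pow_mem _ hcen j
  have hcC : c₀ ^ j ∈ C := C.pow_mem hc₀ j
  have hcov := Subgroup.covBy_sup_zpowers hq hj1 hj2
  have hnor : (M ⊔ Subgroup.zpowers (c₀ ^ j)).Normal := by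
    rw [← QuotientGroup.comap_map_mk', MonoidHom.map_zpowers]
    refine Subgroup.Normal.comap ⟨?_⟩ _
    intro n hn g
    have := Subgroup.mem_center_iff.1 (Subgroup.zpowers_le.2 hcen' hn) g
    rwa [this, mul_inv_cancel_right]
  have hle : M ⊔ Subgroup.zpowers (c₀ ^ j) ≤ C := sup_le hMC.le (Subgroup.zpowers_le.2 hcC)
  rcases hle.eq_or_lt with h | h
  · rwa [h] at hcov
  · exact absurd (hmax ⟨hnor, h⟩ le_sup_left) hcov.lt.not_ge

end

/-! ### The Frattini subgroup of a normal `q`-subgroup, seen in `G`. -/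

section

variable {G : Type*} [Group G]

theorem Subgroup.map_subtype_covBy {P : Subgroup G} {M N : Subgroup P} (h : M ⋖ N) :
    M.map P.subtype ⋖ N.map P.subtype := by
  refine ⟨(Subgroup.map_lt_map_iff_of_injective P.subtype_injective).2 h.lt, fun L h1 h2 => ?_⟩
  have hL : L ≤ P := h2.le.trans (Subgroup.map_subtype_le N)
  have e : (L.subgroupOf P).map P.subtype = L := by
    rw [Subgroup.subgroupOf_map_subtype, inf_of_le_left hL]
  rw [← e, Subgroup.map_lt_map_iff_of_injective P.subtype_injective] at h1 h2
  exact h.2 h1 h2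

variable [Finite G] {q : ℕ}

/-- The Frattini subgroup of a normal `q`-subgroup `P` of `G`, with the properties that
characterize it. -/
theorem Subgroup.exists_frattini_of_isPGroup (hq : q.Prime) {P : Subgroup G} [P.Normal]
    (hP : IsPGroup q P) : ∃ Φ : Subgroup G, Φ.Normal ∧ Φ ≤ P ∧
      (∀ S ≤ P, P ≤ S ⊔ Φ → P ≤ S) ∧
      ∀ S ≤ P, Φ ≤ S → ∀ x ∈ P, x ∉ S → ∃ M : Subgroup G, M ⋖ P ∧ S ≤ M ∧ x ∉ M := by
  have : (frattini P).Characteristic := frattini_characteristic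
  refine ⟨(frattini P).map P.subtype, ConjAct.normal_of_characteristic_of_normal,
    Subgroup.map_subtype_le _, ?_, ?_⟩
  · intro S hS h
    have e : (S.subgroupOf P).map P.subtype = S := by
      rw [Subgroup.subgroupOf_map_subtype, inf_of_le_left hS]
    have h2 : S.subgroupOf P ⊔ frattini P = ⊤ := by
      rw [eq_top_iff, ← Subgroup.map_le_map_iff_of_injective P.subtype_injective,
        Subgroup.map_sup, e, ← MonoidHom.range_eq_map, P.range_subtype]
      exact h
    exact Subgroup.subgroupOf_eq_top.1 (frattini_nongenerating h2)
  · intro S hS hΦ x hx hxS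
    have h1 : frattini P ≤ S.subgroupOf P := Subgroup.map_le_iff_le_comap.1 hΦ
    obtain ⟨M, hM, hSM, hxM⟩ := hP.exists_isCoatom_of_frattini_le hq h1
      (x := ⟨x, hx⟩) (fun h => hxS (Subgroup.mem_subgroupOf.1 h))
    refine ⟨M.map P.subtype, ?_, ?_, ?_⟩
    · have := Subgroup.map_subtype_covBy (covBy_top_iff.2 hM)
      rwa [← MonoidHom.range_eq_map, P.range_subtype] at this
    · intro s hs
      exact ⟨⟨s, hS hs⟩, hSM (Subgroup.mem_subgroupOf.2 hs), rfl⟩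
    · rintro ⟨y, hy, hyx⟩
      have : y = ⟨x, hx⟩ := Subtype.ext hyx
      exact hxM (this ▸ hy)

end

/-! ### Lifting `p`-nilpotency from a quotient. -/

section

variable {G : Type*} [Group G]

/-- Lifting `p`-nilpotency along a normal subgroup `N` with a normal Sylow `p`-subgroup `P` that is
centralized by the `p'`-elements. -/
theorem IsPNilpotentGroup.of_quotient [Finite G] {p : ℕ} (hp : p.Prime) {N P : Subgroup G}
    [N.Normal] [P.Normal] (hPN : P ≤ N) (hP : IsPGroup p P) (hi : ¬ p ∣ P.relIndex N)
    (hcom : ∀ r : ℕ, r.Prime → r ≠ p → ∀ x : G, (∃ k : ℕ, x ^ r ^ k = 1) → ∀ y ∈ P, Commute x y)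
    (hG : IsPNilpotentGroup p (G ⧸ N)) : IsPNilpotentGroup p G := by
  have := Fact.mk hp
  obtain ⟨K₀, hK₀, hcK, k, hk⟩ := hG
  -- `K` is the preimage of the normal `p`-complement of `G/N`. Its normal `p`-subgroup `P` has
  -- index prime to `p` in `K`, so Schur–Zassenhaus provides a complement `H` of `P` in `K`.
  obtain ⟨K, hKdef⟩ : ∃ K, K = K₀.comap (QuotientGroup.mk' N) := ⟨_, rfl⟩
  have hKn : K.Normal := hKdef ▸ inferInstance
  have hNK : N ≤ K := by
    rw [hKdef]
    exact (QuotientGroup.le_comap_mk' N K₀)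
  have hKi : K.index = p ^ k := by
    rw [hKdef, Subgroup.index_comap_of_surjective _ (QuotientGroup.mk'_surjective N), hk]
  have hNKi : N.relIndex K = Nat.card K₀ := by
    have h1 := Subgroup.relIndex_mul_index hNK
    have h2 := K₀.card_mul_index
    rw [hKi] at h1
    rw [hk, ← Subgroup.index_eq_card, ← h1] at h2
    exact (Nat.eq_of_mul_eq_mul_right (pow_pos hp.pos k) h2).symm
  have hPK : P ≤ K := hPN.trans hNK
  have hPKi : p.Coprime (P.relIndex K) := by
    rw [← Subgroup.relIndex_mul_relIndex P N K hPN hNK, hNKi]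
    exact ((Nat.Prime.coprime_iff_not_dvd hp).2 hi).mul_right hcK.symm
  obtain ⟨n, hn⟩ := IsPGroup.iff_card.1 hP
  have hcP : Nat.card (P.subgroupOf K) = p ^ n := by
    rw [Nat.card_congr (Subgroup.subgroupOfEquivOfLe hPK).toEquiv, hn]
  have hcop : (Nat.card (P.subgroupOf K)).Coprime (P.subgroupOf K).index := by
    rw [hcP]
    exact hPKi.pow_left n
  obtain ⟨H, hH⟩ := Subgroup.exists_right_complement'_of_coprime hcop
  have hcH : Nat.card H = P.relIndex K := hH.symm.index_eq_card.symm
  have hHi : H.index = p ^ n := by rw [hH.index_eq_card, hcP]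
  have hHP : ∀ h ∈ H, ∀ y ∈ P.subgroupOf K, y * h = h * y := by
    have : H ≤ Subgroup.centralizer (P.subgroupOf K : Set K) := by
      apply Subgroup.le_of_forall_primePow
      rintro r hr x hx ⟨l, hl⟩
      rw [Subgroup.mem_centralizer_iff]
      intro y hy
      by_cases hrp : r = p
      · have hx1 : x = 1 := by
          have h1 : x ^ Nat.card H = 1 :=
            congrArg Subtype.val (pow_card_eq_one' (x := (⟨x, hx⟩ : H)))
          have := (⊥ : Subgroup K).mem_of_pow_mem_of_coprime (x := x) (a := r ^ l)
            (b := Nat.card H) (by rw [hrp, hcH]; exact hPKi.pow_left l) (by simp [hl]) (by simp [h1])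
          simpa using this
        rw [hx1, mul_one, one_mul]
      · have hl' : (x : G) ^ r ^ l = 1 := by simpa using congrArg Subtype.val hl
        exact Subtype.ext (hcom r hr hrp x ⟨l, hl'⟩ y hy).symm
    exact fun h hh y hy => Subgroup.mem_centralizer_iff.1 (this hh) y hy
  -- `H` is normalized by itself and centralized by `P`, and together they generate `K`.
  have hHn : H.Normal := by
    rw [← Subgroup.normalizer_eq_top_iff, eq_top_iff, ← hH.sup_eq_top]
    refine sup_le ?_ Subgroup.le_normalizer
    intro y hy
    refine Subgroup.centralizer_le_normalizer _ (Subgroup.mem_centralizer_iff.2 ?_)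
    exact fun h hh => (hHP h hh y hy).symm
  have hidx : (H.map K.subtype).index = p ^ n * p ^ k := by
    rw [← Subgroup.relIndex_mul_index (Subgroup.map_subtype_le H), hKi, Subgroup.relIndex,
      Subgroup.subgroupOf, Subgroup.comap_map_eq_self_of_injective K.subtype_injective, hHi]
  refine ⟨H.map K.subtype, ⟨?_⟩, ?_, n + k, by rw [hidx, pow_add]⟩
  · rintro _ ⟨x, hx, rfl⟩ g
    refine ⟨⟨g * x * g⁻¹, hKn.conj_mem _ x.2 g⟩, ?_, rfl⟩
    -- Normality in `G`: the conjugate is killed by `|H|`, and its power with exponent `p ^ n`, the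
    -- index of the normal subgroup `H` of `K`, lies in `H`. The two exponents are coprime.
    refine H.mem_of_pow_mem_of_coprime (a := Nat.card H) (b := p ^ n) ?_ ?_ ?_
    · rw [hcH]
      exact (hPKi.pow_left n).symm
    · have h1 : x ^ Nat.card H = 1 :=
        congrArg Subtype.val (pow_card_eq_one' (x := (⟨x, hx⟩ : H)))
      have h2 : (x : G) ^ Nat.card H = 1 := by simpa using congrArg Subtype.val h1
      convert H.one_mem
      apply Subtype.ext
      change (g * x * g⁻¹) ^ Nat.card H = 1
      rw [conj_pow, h2, mul_one, mul_inv_cancel]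
    · rw [← hHi]
      exact H.pow_index_mem _
  · rw [Nat.card_congr (H.equivMapOfInjective _ K.subtype_injective).toEquiv.symm, hcH]
    exact hPKi.symm

theorem IsPNilpotentGroup.of_mulEquiv {p : ℕ} {G' : Type*} [Group G'] (e : G ≃* G')
    (h : IsPNilpotentGroup p G) : IsPNilpotentGroup p G' := by
  obtain ⟨N, hN, hc, k, hk⟩ := h
  refine ⟨N.map e.toMonoidHom, hN.map _ e.surjective, ?_, k, ?_⟩
  · rwa [Nat.card_congr (N.equivMapOfInjective e.toMonoidHom e.injective).toEquiv.symm]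
  · rw [← hk]
    exact Subgroup.index_map_equiv N e

end

/-! ### Chief factors and the supersoluble hypercenter. -/

section

variable {G : Type u} [Group G]

/-- If `N (j + 1)` is the first term of the series containing `V`, then `N j` meets `V` trivially by
minimality, so `V` embeds in the cyclic factor above `N j`. -/
theorem IsSupersolubleGroup.isCyclic_of_minimal {V : Subgroup G} (hG : IsSupersolubleGroup G)
    [V.Normal] (hV : V ≠ ⊥)
    (hmin : ∀ N : Subgroup G, N.Normal → N ≤ V → N = ⊥ ∨ N = V) : IsCyclic V := by
  classical
  obtain ⟨n, N, hN, h0, hn, hs⟩ := hG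
  have hex : ∃ i, V ≤ N i := ⟨n, hn ▸ le_top⟩
  obtain ⟨j, hj⟩ : ∃ j, Nat.find hex = j + 1 := by
    refine Nat.exists_eq_succ_of_ne_zero fun h => hV ?_
    have := Nat.find_spec hex
    rwa [h, h0, le_bot_iff] at this
  have hVj : V ≤ N (j + 1) := hj ▸ Nat.find_spec hex
  have hVj' : ¬ V ≤ N j := Nat.find_min hex (by omega)
  have hjn : j < n := by
    have := Nat.find_min' hex (show V ≤ N n from hn ▸ le_top)
    omega
  have hbot : N j ⊓ V = ⊥ :=
    (hmin _ inferInstance inf_le_right).resolve_right fun h => hVj' (inf_eq_right.1 h)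
  have hcyc := (hs j hjn).2
  let f : V →* (N (j + 1)).map (QuotientGroup.mk' (N j)) :=
    ((QuotientGroup.mk' (N j)).comp V.subtype).codRestrict _
      fun v => Subgroup.mem_map_of_mem _ (hVj v.2)
  refine isCyclic_of_injective f ((injective_iff_map_eq_one f).2 fun v hv => ?_)
  have h1 : ((v : G) : G ⧸ N j) = 1 := congrArg Subtype.val hv
  have h2 : (v : G) ∈ N j ⊓ V := ⟨(QuotientGroup.eq_one_iff _).1 h1, v.2⟩
  rw [hbot, Subgroup.mem_bot] at h2
  exact Subtype.ext h2

/-- A chief factor `H / K` has no proper nontrivial subgroup invariant under the action of `G`. -/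
theorem IsChiefFactor.eq_bot_or_eq_top {H K : Subgroup G} [H.Normal] [K.Normal]
    (h : IsChiefFactor H K) (U : Subgroup (sectionQuotient H K))
    (hU : ∀ g : G, ∀ u ∈ U, sectionConj H K g u ∈ U) : U = ⊥ ∨ U = ⊤ := by
  obtain ⟨-, -, hKH, hmin⟩ := h
  let L : Subgroup G := (U.map (sectionQuotient H K).subtype).comap (QuotientGroup.mk' K)
  have hL : L.Normal := by
    constructor
    rintro x ⟨u, hu, hux⟩ g
    refine ⟨sectionConj H K g u, hU g u hu, ?_⟩
    rw [map_mul, map_mul, map_inv, ← hux]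
    rfl
  have hKL : K ≤ L := QuotientGroup.le_comap_mk' K _
  have hker : (QuotientGroup.mk' K).ker = K := QuotientGroup.ker_mk' K
  have hLH : L ≤ H := by
    have h1 : L ≤ (sectionQuotient H K).comap (QuotientGroup.mk' K) :=
      Subgroup.comap_mono (Subgroup.map_subtype_le U)
    rwa [QuotientGroup.comap_map_mk', sup_of_le_right hKH.le] at h1
  rcases hmin L hL hKL hLH with e | e
  · left
    rw [eq_bot_iff]
    intro u hu
    obtain ⟨x, hx, hxu⟩ := u.2
    have : x ∈ L := ⟨u, hu, hxu.symm⟩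
    rw [e] at this
    rw [Subgroup.mem_bot]
    refine Subtype.ext ?_
    rw [← hxu]
    exact (QuotientGroup.eq_one_iff x).2 this
  · right
    rw [eq_top_iff]
    rintro u -
    obtain ⟨x, hx, hxu⟩ := u.2
    have hxH : x ∈ H := hx
    rw [← e] at hxH
    obtain ⟨u', hu', h'⟩ := hxH
    have : u' = u := Subtype.ext (h'.trans hxu)
    exact this ▸ hu'

theorem card_sectionQuotient {H K : Subgroup G} [K.Normal] :
    Nat.card (sectionQuotient H K) = K.relIndex H := by
  rw [← Subgroup.relIndex_bot_left, ← Subgroup.relIndex_comap, MonoidHom.comap_bot,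
    QuotientGroup.ker_mk']

theorem IsChiefFactor.map_mk' {C A : Subgroup G} [A.Normal] (h : IsChiefFactor C A) :
    IsChiefFactor (C.map (QuotientGroup.mk' A)) ⊥ := by
  obtain ⟨hC, -, hAC, hmin⟩ := h
  have hsurj := QuotientGroup.mk'_surjective A
  have hCc : (C.map (QuotientGroup.mk' A)).comap (QuotientGroup.mk' A) = C := by
    rw [QuotientGroup.comap_map_mk', sup_of_le_right hAC.le]
  refine ⟨hC.map _ hsurj, inferInstance, bot_lt_iff_ne_bot.2 ?_, ?_⟩
  · rw [Ne, Subgroup.map_eq_bot_iff, QuotientGroup.ker_mk']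
    exact hAC.not_ge
  · intro N hN _ hNC
    have h1 := hmin (N.comap (QuotientGroup.mk' A)) inferInstance (QuotientGroup.le_comap_mk' A N)
      (hCc ▸ Subgroup.comap_mono hNC)
    rw [← Subgroup.map_comap_eq_self_of_surjective hsurj N]
    rcases h1 with h1 | h1
    · left
      rw [h1, Subgroup.map_eq_bot_iff, QuotientGroup.ker_mk']
    · right
      rw [h1]

instance hypercenterOf_normal (𝔉 : GroupClass.{u}) : (hypercenterOf G 𝔉).Normal :=
  Subgroup.sSup_normal _ fun _ h => h.1

/-- For a generator `v` and a prime `l` dividing the order, the subgroup generated by `v ^ l` is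
proper and invariant under all automorphisms, so it is trivial in a chief factor. -/
theorem IsChiefFactor.relIndex_prime_of_isCyclic [Finite G] {H K : Subgroup G} [H.Normal]
    [K.Normal] (h : IsChiefFactor H K) (hc : IsCyclic (sectionQuotient H K)) :
    (K.relIndex H).Prime := by
  rw [← card_sectionQuotient]
  obtain ⟨v, hv⟩ := hc.exists_generator
  have hne : Nat.card (sectionQuotient H K) ≠ 1 := by
    rw [card_sectionQuotient, Ne, Subgroup.relIndex_eq_one]
    exact h.2.2.1.not_ge
  obtain ⟨l, hl, hld⟩ := Nat.exists_prime_and_dvd hne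
  have hinv : ∀ g : G, ∀ u ∈ Subgroup.zpowers (v ^ l),
      sectionConj H K g u ∈ Subgroup.zpowers (v ^ l) := by
    intro g u hu
    obtain ⟨i, rfl⟩ := Subgroup.mem_zpowers_iff.1 hu
    obtain ⟨j, hj⟩ := Subgroup.mem_zpowers_iff.1 (hv (sectionConj H K g v))
    rw [map_zpow, map_pow, ← hj]
    refine Subgroup.mem_zpowers_iff.2 ⟨j * i, ?_⟩
    simp only [← zpow_natCast, ← zpow_mul]
    congr 1
    ring
  have hord : orderOf v = Nat.card (sectionQuotient H K) := orderOf_eq_card_of_forall_mem_zpowers hv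
  rcases h.eq_bot_or_eq_top _ hinv with e | e
  · have h1 : v ^ l = 1 := Subgroup.zpowers_eq_bot.1 e
    rw [← hord] at hne ⊢
    rcases (Nat.dvd_prime hl).1 (orderOf_dvd_of_pow_eq_one h1) with h2 | h2
    · exact absurd h2 hne
    · exact h2 ▸ hl
  · exfalso
    have h1 : orderOf (v ^ l) = Nat.card (sectionQuotient H K) := by
      rw [← Nat.card_zpowers, e, Subgroup.card_top]
    rw [orderOf_pow, hord, Nat.gcd_eq_right hld] at h1
    exact absurd h1 (Nat.div_lt_self Nat.card_pos hl.one_lt).ne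

/-- Inside the semidirect product, `H / K` is a minimal normal subgroup, because a normal subgroup
below it is invariant under the action of `G`. Supersolubility makes it cyclic. -/
theorem IsChiefFactor.relIndex_prime_of_isCentralSection [Finite G] {H K : Subgroup G} [H.Normal]
    [K.Normal] (h : IsChiefFactor H K) (hc : IsCentralSection IsSupersolubleGroup H K) :
    (K.relIndex H).Prime := by
  apply h.relIndex_prime_of_isCyclic
  let φ := QuotientGroup.kerLift (sectionConj H K)
  let i : sectionQuotient H K →* sectionSemidirect H K := SemidirectProduct.inl
  have hi : Function.Injective i := SemidirectProduct.inl_injective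
  have hn : i.range.Normal := by
    have : i.range = (SemidirectProduct.rightHom (φ := φ)).ker :=
      SemidirectProduct.range_inl_eq_ker_rightHom
    rw [this]
    infer_instance
  have hne : i.range ≠ ⊥ := by
    intro e
    have h1 := card_sectionQuotient (H := H) (K := K)
    rw [Nat.card_congr (MonoidHom.ofInjective hi).toEquiv, e, Subgroup.card_bot] at h1
    exact h.2.2.1.not_ge (Subgroup.relIndex_eq_one.1 h1.symm)
  have hcyc : IsCyclic i.range := by
    refine IsSupersolubleGroup.isCyclic_of_minimal hc hne ?_
    intro N hN hNi
    have hNe : (N.comap i).map i = N := Subgroup.map_comap_eq_self hNi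
    have hinv : ∀ g : G, ∀ u ∈ N.comap i, sectionConj H K g u ∈ N.comap i := by
      intro g u hu
      have := hN.conj_mem _ hu (SemidirectProduct.inr (g : G ⧸ sectionCentralizer H K))
      rw [← map_inv, ← SemidirectProduct.inl_aut] at this
      exact this
    rcases h.eq_bot_or_eq_top _ hinv with e | e
    · left
      rw [← hNe, e, Subgroup.map_bot]
    · right
      rw [← hNe, e, ← MonoidHom.range_eq_map]
  exact isCyclic_of_injective i.rangeRestrict (MonoidHom.rangeRestrict_injective_iff.2 hi)

/-- A minimal normal subgroup in the supersoluble hypercenter has prime order. -/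
theorem IsChiefFactor.card_prime_of_le_hypercenterOf [Finite G] {C : Subgroup G}
    (hC : IsChiefFactor C ⊥) (hZ : C ≤ hypercenterOf G IsSupersolubleGroup) :
    (Nat.card C).Prime := by
  obtain ⟨hCn, -, hC0, hCmin⟩ := hC
  -- The hypercenter is only generated by the defining subgroups `N`, and `C` is not known to lie in
  -- one of them. For `Y` maximal among the normal subgroups not containing `C`, some `N` is not in
  -- `Y`, and then `(N ∩ CY)/(N ∩ Y)` is a chief factor below `N` of order `|C|`.
  obtain ⟨Y, ⟨hY, hCY⟩, hmax⟩ :=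
    (Set.toFinite {Y : Subgroup G | Y.Normal ∧ ¬ C ≤ Y}).exists_maximal
      ⟨⊥, inferInstance, fun h => hC0.not_ge h⟩
  have hmem : ∀ L : Subgroup G, L.Normal → ¬ L ≤ Y → C ≤ Y ⊔ L := by
    intro L hL hLY
    by_contra h
    exact hLY (le_sup_right.trans (hmax ⟨inferInstance, h⟩ le_sup_left))
  obtain ⟨N, ⟨hN, hgood⟩, hNY⟩ : ∃ N : Subgroup G, (N.Normal ∧
      ∀ (H K : Subgroup G) [H.Normal] [K.Normal],
        IsChiefFactor H K → H ≤ N → IsCentralSection IsSupersolubleGroup H K) ∧ ¬ N ≤ Y := by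
    by_contra! h
    exact hCY (hZ.trans (sSup_le h))
  have hC2 : C ≤ Y ⊔ N ⊓ (C ⊔ Y) := by
    intro c hc
    obtain ⟨y, hy, n, hn, rfl⟩ := Subgroup.mem_sup_of_normal_left.1 (hmem N hN hNY hc)
    refine Subgroup.mul_mem_sup hy ⟨hn, ?_⟩
    rw [← inv_mul_cancel_left y n]
    exact mul_mem (Subgroup.mem_sup_right (inv_mem hy)) (Subgroup.mem_sup_left hc)
  have hchief : IsChiefFactor (N ⊓ (C ⊔ Y)) (N ⊓ Y) := by
    refine ⟨inferInstance, inferInstance, lt_of_le_of_ne (inf_le_inf_left N le_sup_right) ?_, ?_⟩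
    · intro e
      rw [← e] at hC2
      exact hCY (hC2.trans (sup_le le_rfl inf_le_right))
    · intro L hL hL1 hL2
      by_cases hLY : L ≤ Y
      · left
        exact le_antisymm (le_inf (hL2.trans inf_le_left) hLY) hL1
      · right
        refine le_antisymm hL2 ?_
        rintro x ⟨hxN, hx⟩
        have h1 : x ∈ Y ⊔ L := sup_le (hmem L hL hLY) le_sup_left hx
        obtain ⟨y, hy, l, hl, rfl⟩ := Subgroup.mem_sup_of_normal_left.1 h1
        refine L.mul_mem (hL1 ⟨?_, hy⟩) hl
        exact (N.mul_mem_cancel_right (hL2 hl).1).1 hxN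
  have hp := hchief.relIndex_prime_of_isCentralSection (hgood _ _ hchief inf_le_left)
  have e1 : (N ⊓ Y).relIndex (N ⊓ (C ⊔ Y)) = Y.relIndex (N ⊓ (C ⊔ Y)) := by
    rw [← Subgroup.inf_relIndex_right (N ⊓ Y), ← Subgroup.inf_relIndex_right Y]
    congr 1
    ext x
    simp only [Subgroup.mem_inf]
    tauto
  have e2 : (N ⊓ (C ⊔ Y)) ⊔ Y = C ⊔ Y := by
    refine le_antisymm (sup_le inf_le_right le_sup_right) (sup_le ?_ le_sup_right)
    rw [sup_comm]
    exact hC2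
  have e3 : Y ⊓ C = ⊥ :=
    (hCmin _ inferInstance bot_le inf_le_right).resolve_right fun h => hCY (inf_eq_right.1 h)
  rwa [e1, ← Subgroup.relIndex_sup_right (N ⊓ (C ⊔ Y)) Y, e2, Subgroup.relIndex_sup_right,
    ← Subgroup.inf_relIndex_right, e3, Subgroup.relIndex_bot_left] at hp

end

/-! ### `s`-permutability, quasinormal maximal subgroups and their effect on chief factors. -/

section

variable {G : Type u} [Group G] [Finite G] {q : ℕ}

/-- Only `P` is normal, so the index is found by comparing the two chains from `L ∩ P` to `LP`,
through `L` and through `P`. -/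
theorem Subgroup.relIndex_sup_of_normal (L P : Subgroup G) [P.Normal] :
    L.relIndex (L ⊔ P) = L.relIndex P := by
  have h1 := Subgroup.relIndex_mul_relIndex (L ⊓ P) L (L ⊔ P) inf_le_left le_sup_left
  have h2 := Subgroup.relIndex_mul_relIndex (L ⊓ P) P (L ⊔ P) inf_le_right le_sup_right
  rw [Subgroup.inf_relIndex_left] at h1
  rw [Subgroup.inf_relIndex_right, Subgroup.relIndex_sup_right, ← h1, mul_comm] at h2
  exact (Nat.eq_of_mul_eq_mul_left
    (Nat.pos_of_dvd_of_pos (Subgroup.relIndex_dvd_card P L) Nat.card_pos) h2).symm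

/-- If a subgroup `L` permutes with an `r`-subgroup `R`, then `LR` is a subgroup and its index
over `L` is a power of `r`. -/
theorem Subgroup.exists_mul_of_permutable {r : ℕ} (hr : r.Prime) {L R : Subgroup G}
    (hR : IsPGroup r R) (h : (L : Set G) * R = R * L) :
    ∃ J : Subgroup G, L ≤ J ∧ R ≤ J ∧ ∃ n : ℕ, L.relIndex J = r ^ n := by
  have := Fact.mk hr
  let J : Subgroup G :=
    { carrier := (R : Set G) * L
      mul_mem' := by
        intro a b ha hb
        have h1 : (R : Set G) * L * (R * L) = R * L := by
          rw [mul_assoc, ← mul_assoc (L : Set G), h, mul_assoc, ← mul_assoc,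
            coe_mul_coe, coe_mul_coe]
        exact h1 ▸ Set.mul_mem_mul ha hb
      one_mem' := ⟨1, R.one_mem, 1, L.one_mem, mul_one 1⟩
      inv_mem' := by
        rintro _ ⟨x, hx, l, hl, rfl⟩
        change (x * l)⁻¹ ∈ (R : Set G) * L
        rw [mul_inv_rev, ← h]
        exact Set.mul_mem_mul (L.inv_mem hl) (R.inv_mem hx) }
  have hLJ : L ≤ J := fun l hl => ⟨1, R.one_mem, l, hl, one_mul l⟩
  refine ⟨J, hLJ, fun x hx => ⟨x, hx, 1, L.one_mem, mul_one x⟩, ?_⟩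
  -- The `R`-orbit of the coset `L` in `G ⧸ L` has size a power of `r`, and it consists of the
  -- cosets that make up `RL`.
  obtain ⟨n, hn⟩ := hR.card_orbit (((1 : G) : G ⧸ L))
  refine ⟨n, ?_⟩
  have e : MulAction.orbit R (((1 : G) : G ⧸ L)) = (QuotientGroup.mk '' (R : Set G) : Set (G ⧸ L)) := by
    ext y
    constructor
    · rintro ⟨x, rfl⟩
      refine ⟨x, x.2, ?_⟩
      change ((x : G) : G ⧸ L) = (((x : G) * 1 : G) : G ⧸ L)
      rw [mul_one]
    · rintro ⟨x, hx, rfl⟩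
      refine ⟨⟨x, hx⟩, ?_⟩
      change ((x * 1 : G) : G ⧸ L) = (x : G ⧸ L)
      rw [mul_one]
  have h1 : Nat.card J = Nat.card L * r ^ n := by
    rw [← hn, e]
    exact Subgroup.card_mul_eq_card_subgroup_mul_card_quotient L (R : Set G)
  have h2 : Nat.card L * L.relIndex J = Nat.card J := by
    rw [← Subgroup.relIndex_bot_left L, Subgroup.relIndex_mul_relIndex ⊥ L J bot_le hLJ,
      Subgroup.relIndex_bot_left]
  rw [h1] at h2
  exact Nat.eq_of_mul_eq_mul_left Nat.card_pos h2

/-- With `J = LR`, the subgroup `P ∩ J` is `M` or `P`. If `P ≤ J`, then `|LP : L|` is a power of `q`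
dividing a power of `r`, so `P ≤ L`, against `P ∩ L = M < P`. Hence `M = P ∩ J` is normalized by
`J`, which contains `R`. -/
theorem IsSPermutable.le_normalizer_inf {L P M : Subgroup G} (hL : IsSPermutable L) [P.Normal]
    (hq : q.Prime) (hP : IsPGroup q P) (hM : M ⋖ P) (hPL : P ⊓ L = M) {r : ℕ} (hr : r.Prime)
    (hrq : r ≠ q) (R : Sylow r G) : (R : Subgroup G) ≤ Subgroup.normalizer (M : Set G) := by
  have := Fact.mk hq
  obtain ⟨J, hLJ, hRJ, n, hn⟩ := Subgroup.exists_mul_of_permutable hr R.2 (hL r hr R)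
  have hPJ : P ⊓ J = M := by
    refine (hM.eq_or_eq (hPL ▸ inf_le_inf_left P hLJ) inf_le_left).resolve_right fun h => ?_
    have hPJ : P ≤ J := inf_eq_left.1 h
    have h1 := Subgroup.relIndex_mul_relIndex L (L ⊔ P) J le_sup_left (sup_le hLJ hPJ)
    rw [Subgroup.relIndex_sup_of_normal, hn] at h1
    obtain ⟨m, hm⟩ := IsPGroup.iff_card.1 hP
    have h2 : L.relIndex P ∣ q ^ m := hm ▸ Subgroup.relIndex_dvd_card L P
    have h3 : L.relIndex P = 1 :=
      Nat.eq_one_of_dvd_coprimes (((Nat.coprime_primes hr hq).2 hrq).pow n m)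
        (Dvd.intro _ h1) h2
    have h4 : P ≤ M := hPL ▸ le_inf le_rfl (Subgroup.relIndex_eq_one.1 h3)
    exact hM.lt.not_ge h4
  rw [← hPJ]
  exact (le_inf (le_top.trans (Subgroup.normalizer_eq_top_iff.2 inferInstance).ge)
    (hRJ.trans Subgroup.le_normalizer)).trans (Subgroup.inf_normalizer_le_normalizer_inf)

theorem Subgroup.normal_of_forall_sylow_le {M : Subgroup G}
    (h : ∀ r : ℕ, r.Prime → ∃ R : Sylow r G, (R : Subgroup G) ≤ Subgroup.normalizer (M : Set G)) :
    M.Normal := by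
  rw [← Subgroup.normalizer_eq_top_iff, ← Subgroup.index_eq_one]
  by_contra hne
  obtain ⟨l, hl, hld⟩ := Nat.exists_prime_and_dvd hne
  have := Fact.mk hl
  obtain ⟨R, hR⟩ := h l hl
  exact R.not_dvd_index (hld.trans (Subgroup.index_dvd_of_le hR))

theorem IsChiefFactor.relIndex_prime_of_covBy {C A : Subgroup G} [C.Normal] [A.Normal]
    (h : IsChiefFactor C A) (hc : A ⋖ C) : (A.relIndex C).Prime := by
  apply h.relIndex_prime_of_isCyclic
  obtain ⟨x, hxC, hxA⟩ := SetLike.exists_of_lt hc.lt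
  have h1 : A < A ⊔ Subgroup.zpowers x := left_lt_sup.2 fun h => hxA (h (Subgroup.mem_zpowers x))
  have h2 : A ⊔ Subgroup.zpowers x = C :=
    (hc.eq_or_eq h1.le (sup_le hc.le (Subgroup.zpowers_le.2 hxC))).resolve_left h1.ne'
  have h3 : sectionQuotient C A = Subgroup.zpowers (QuotientGroup.mk' A x) := by
    rw [sectionQuotient, ← h2, Subgroup.map_sup, MonoidHom.map_zpowers,
      (Subgroup.map_eq_bot_iff A).2 (QuotientGroup.ker_mk' A).ge, bot_sup_eq]
  rw [h3]
  infer_instance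

/-- One nontrivial element of `C / A` in the hypercenter is enough: the intersection of the two is
normal, so by minimality it is all of `C / A`. -/
theorem IsChiefFactor.relIndex_prime_of_mem_hypercenterOf {C A : Subgroup G} [C.Normal] [A.Normal]
    (h : IsChiefFactor C A) {m : G} (hmC : m ∈ C) (hmA : m ∉ A)
    (hm : QuotientGroup.mk' A m ∈ hypercenterOf (G ⧸ A) IsSupersolubleGroup) :
    (A.relIndex C).Prime := by
  have h1 := h.map_mk'
  have := h1.1
  rw [← card_sectionQuotient]
  refine h1.card_prime_of_le_hypercenterOf ?_
  rcases h1.2.2.2 (C.map (QuotientGroup.mk' A) ⊓ hypercenterOf (G ⧸ A) IsSupersolubleGroup)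
    inferInstance bot_le inf_le_left with e | e
  · exfalso
    have h2 : QuotientGroup.mk' A m ∈ C.map (QuotientGroup.mk' A) ⊓
        hypercenterOf (G ⧸ A) IsSupersolubleGroup := ⟨Subgroup.mem_map_of_mem _ hmC, hm⟩
    rw [e, Subgroup.mem_bot] at h2
    exact hmA ((QuotientGroup.eq_one_iff m).1 h2)
  · exact inf_eq_left.1 e

/-- Let `P` be a normal `q`-subgroup of `G`, all of whose maximal subgroups are
`𝔘ₛ`-quasinormal in `G`. If `C / A` is the only minimal normal subgroup of `G / A` in `P / A`, and
`A` is an intersection of maximal subgroups of `P`, together with all the subgroups between `A` and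
`P`, then `C / A` has prime order. -/
theorem relIndex_prime_of_unique_minimal (hq : q.Prime) {P A C : Subgroup G} [P.Normal] [A.Normal]
    [C.Normal] (hP : IsPGroup q P) (hAC : A < C) (hCP : C ≤ P)
    (hsep : ∀ S ≤ P, A ≤ S → ∀ x ∈ P, x ∉ S → ∃ M : Subgroup G, M ⋖ P ∧ S ≤ M ∧ x ∉ M)
    (hquasi : ∀ M : Subgroup G, M ⋖ P → IsSQuasinormalFor IsSupersolubleGroup M)
    (hmin : ∀ N : Subgroup G, N.Normal → A ≤ N → N ≤ P → N = A ∨ C ≤ N) :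
    (A.relIndex C).Prime := by
  have := Fact.mk hq
  have hchief : IsChiefFactor C A := by
    refine ⟨inferInstance, inferInstance, hAC, fun N hN h1 h2 => ?_⟩
    exact (hmin N hN h1 (h2.trans hCP)).imp_right fun h => le_antisymm h2 h
  -- The subgroup `M₁` is chosen normal in a full Sylow `q`-subgroup `Q` of `G`, so that only the
  -- other primes remain when its normality in `G` is tested.
  obtain ⟨Q, hPQ⟩ := hP.exists_le_sylow
  have hCQ := hCP.trans hPQ
  have eA : (A.subgroupOf Q).map (Q : Subgroup G).subtype = A := by
    rw [Subgroup.subgroupOf_map_subtype, inf_of_le_left (hAC.le.trans hCQ)]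
  have eC : (C.subgroupOf Q).map (Q : Subgroup G).subtype = C := by
    rw [Subgroup.subgroupOf_map_subtype, inf_of_le_left hCQ]
  have hltQ : A.subgroupOf Q < C.subgroupOf Q := by
    rw [← Subgroup.map_lt_map_iff_of_injective (Q : Subgroup G).subtype_injective, eA, eC]
    exact hAC
  obtain ⟨M₀, hM₀n, hAM₀, hM₀C⟩ := IsPGroup.exists_normal_covBy hq Q.2 hltQ
  obtain ⟨M₁, hM₁def⟩ : ∃ M₁, M₁ = M₀.map (Q : Subgroup G).subtype := ⟨_, rfl⟩
  have hM₁Q : M₁ ≤ Q := hM₁def ▸ Subgroup.map_subtype_le M₀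
  have hAM₁ : A ≤ M₁ := by
    rw [hM₁def, ← eA]
    exact Subgroup.map_mono hAM₀
  have hM₁C : M₁ ⋖ C := by
    have := Subgroup.map_subtype_covBy hM₀C
    rwa [eC, ← hM₁def] at this
  have hQn : (Q : Subgroup G) ≤ Subgroup.normalizer (M₁ : Set G) := by
    rw [← Subgroup.normal_subgroupOf_iff_le_normalizer hM₁Q, hM₁def, Subgroup.subgroupOf,
      Subgroup.comap_map_eq_self_of_injective (Q : Subgroup G).subtype_injective]
    exact hM₀n
  by_cases hM₁A : M₁ = A
  · exact hchief.relIndex_prime_of_covBy (hM₁A ▸ hM₁C)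
  obtain ⟨x, hxC, hxM₁⟩ := SetLike.exists_of_lt hM₁C.lt
  obtain ⟨M, hMP, hM₁M, hxM⟩ := hsep M₁ (hM₁C.le.trans hCP) hAM₁ x (hCP hxC) hxM₁
  have hMC : M ⊓ C = M₁ :=
    (hM₁C.eq_or_eq (le_inf hM₁M hM₁C.le) inf_le_right).resolve_right
      fun h => hxM (inf_eq_right.1 h hxC)
  -- The core contains `A`, and if it were larger it would contain `C`, although `x` is not in `M`.
  have hcore : M.normalCore = A :=
    (hmin _ inferInstance (Subgroup.normal_le_normalCore.2 (hAM₁.trans hM₁M))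
      (M.normalCore_le.trans hMP.le)).resolve_right fun h => hxM (M.normalCore_le (h hxC))
  obtain ⟨T, hT, hperm, hhyp⟩ := hquasi M hMP
  -- If `P ∩ T ≤ M`, then `P ∩ MT = M`, so the Sylow subgroups for the other primes normalize `M`
  -- and hence `M₁ = M ∩ C`. Then `M₁` is normal in `G`, strictly between `A` and `C`.
  by_cases hPT : P ⊓ T ≤ M
  · exfalso
    have hPL : P ⊓ (M ⊔ T) = M := by
      refine le_antisymm ?_ (le_inf hMP.le le_sup_left)
      rintro y ⟨hyP, hy⟩
      obtain ⟨m, hm, t, ht, rfl⟩ := Subgroup.mem_sup_of_normal_right.1 hy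
      exact M.mul_mem hm (hPT ⟨(P.mul_mem_cancel_left (hMP.le hm)).1 hyP, ht⟩)
    have hn : M₁.Normal := by
      apply Subgroup.normal_of_forall_sylow_le
      intro r hr
      by_cases hrq : r = q
      · subst hrq
        exact ⟨Q, hQn⟩
      · have := Fact.mk hr
        obtain ⟨R⟩ : Nonempty (Sylow r G) := inferInstance
        refine ⟨R, ?_⟩
        rw [← hMC]
        exact (le_inf (hperm.le_normalizer_inf hq hP hMP hPL hr hrq R)
          (le_top.trans (Subgroup.normalizer_eq_top_iff.2 inferInstance).ge)).trans
          Subgroup.inf_normalizer_le_normalizer_inf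
    rcases hmin M₁ hn hAM₁ (hM₁C.le.trans hCP) with h | h
    · exact hM₁A h
    · exact hM₁C.lt.not_ge h
  -- Otherwise `A(P ∩ T)` is normal and larger than `A`, so it contains `C`. Thus `M₁ ≤ A(M ∩ T)`,
  -- and `M₁/A` supplies a nontrivial element of the hypercenter of `G/A`.
  · have hCW : C ≤ A ⊔ P ⊓ T := by
      refine (hmin _ inferInstance le_sup_left (sup_le (hAC.le.trans hCP) inf_le_left)).resolve_left
        fun h => hPT ?_
      exact (le_sup_right.trans h.le).trans (hAM₁.trans hM₁M)
    obtain ⟨m, hm, hmA⟩ := SetLike.exists_of_lt (lt_of_le_of_ne hAM₁ (Ne.symm hM₁A))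
    have hmem : m ∈ M ⊓ T ⊔ M.normalCore := by
      obtain ⟨a, ha, t, ht, rfl⟩ := Subgroup.mem_sup_of_normal_left.1 (hCW (hM₁C.le hm))
      refine mul_mem (Subgroup.mem_sup_right (hcore ▸ ha)) (Subgroup.mem_sup_left ⟨?_, ht.2⟩)
      exact (M.mul_mem_cancel_left (hM₁M (hAM₁ ha))).1 (hM₁M hm)
    have hz := hhyp (Subgroup.mem_map_of_mem _ hmem)
    subst hcore
    exact hchief.relIndex_prime_of_mem_hypercenterOf (hM₁C.le hm) hmA hz

/-- Let `P` be a normal `q`-subgroup of `G`, all of whose maximal subgroups are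
`𝔘ₛ`-quasinormal in `G`. The chief factors of `G` between the Frattini subgroup of `P` and `P` have
prime order. -/
theorem IsChiefFactor.relIndex_prime_of_quasinormal (hq : q.Prime) {P Φ B D : Subgroup G} [P.Normal]
    [B.Normal] [D.Normal] (hP : IsPGroup q P)
    (hsep : ∀ S ≤ P, Φ ≤ S → ∀ x ∈ P, x ∉ S → ∃ M : Subgroup G, M ⋖ P ∧ S ≤ M ∧ x ∉ M)
    (hquasi : ∀ M : Subgroup G, M ⋖ P → IsSQuasinormalFor IsSupersolubleGroup M)
    (h : IsChiefFactor B D) (hΦ : Φ ≤ D) (hBP : B ≤ P) : (D.relIndex B).Prime := by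
  obtain ⟨-, hD, hDB, hBmin⟩ := h
  -- Maximality of `A` makes `BA/A` the only minimal normal subgroup of `G/A` in `P/A`. Its order is
  -- that of `B/D`, since `A ∩ B = D`.
  obtain ⟨A, hDA, ⟨hA, hAP, hBA⟩, hmax⟩ :=
    (Set.toFinite {A : Subgroup G | A.Normal ∧ A ≤ P ∧ ¬ B ≤ A}).exists_le_maximal
      ⟨hD, hDB.le.trans hBP, hDB.not_ge⟩
  have hAB : A ⊓ B = D :=
    (hBmin _ inferInstance (le_inf hDA hDB.le) inf_le_right).resolve_right
      fun h => hBA (inf_eq_right.1 h)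
  have key := relIndex_prime_of_unique_minimal (A := A) (C := B ⊔ A) hq hP
    (right_lt_sup.2 hBA) (sup_le hBP hAP) (fun S hS hAS => hsep S hS (hΦ.trans (hDA.trans hAS)))
    hquasi (fun N hN hAN hNP => by
      by_cases hBN : B ≤ N
      · exact Or.inr (sup_le hBN hAN)
      · exact Or.inl (le_antisymm (hmax ⟨hN, hNP, hBN⟩ hAN) hAN))
  rwa [Subgroup.relIndex_sup_right, ← Subgroup.inf_relIndex_right, hAB] at key

/-- An element of the derived subgroup centralizes every section of prime order. -/
theorem commutator_mem_of_relIndex_prime {B D : Subgroup G} [B.Normal] [D.Normal]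
    (h : (D.relIndex B).Prime) {x : G}
    (hx : x ∈ commutator G ∨ (Nat.card G).Coprime (D.relIndex B - 1)) {b : G} (hb : b ∈ B) :
    ⁅x, b⁆ ∈ D := by
  have hcard := card_sectionQuotient (H := B) (K := D)
  have := Fact.mk h
  have hc : IsCyclic (sectionQuotient B D) := isCyclic_of_prime_card hcard
  have h1 : sectionConj B D x = 1 := by
    -- The automorphism group of a group of prime order is abelian, so it kills commutators. Its
    -- order is the prime minus one, so it also kills any element of order prime to that number.
    rcases hx with hx | hx
    · let e := IsCyclic.mulAutMulEquiv (sectionQuotient B D)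
      have h2 := Abelianization.commutator_subset_ker (e.toMonoidHom.comp (sectionConj B D)) hx
      exact e.injective (h2.trans (map_one e).symm)
    · have h2 : orderOf (sectionConj B D x) ∣ Nat.card G :=
        (orderOf_map_dvd _ x).trans (orderOf_dvd_natCard x)
      have h3 : orderOf (sectionConj B D x) ∣ D.relIndex B - 1 := by
        rw [← Nat.totient_prime h, ← hcard, ← IsCyclic.card_mulAut]
        exact orderOf_dvd_natCard _
      exact orderOf_eq_one_iff.1 (Nat.eq_one_of_dvd_coprimes hx h2 h3)
  have h2 := congrArg Subtype.val
    (DFunLike.congr_fun h1 ⟨QuotientGroup.mk' D b, Subgroup.mem_map_of_mem _ hb⟩)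
  have h3 : (x : G ⧸ D) * b * (x : G ⧸ D)⁻¹ = b := h2
  rw [← QuotientGroup.eq_one_iff]
  change (x : G ⧸ D) * b * (x : G ⧸ D)⁻¹ * (b : G ⧸ D)⁻¹ = 1
  rw [h3, mul_inv_cancel]

/-- Let `P` be a normal `q`-subgroup of `G`, all of whose maximal subgroups are
`𝔘ₛ`-quasinormal in `G`. Then `P` is centralized by the elements of prime power order of the
derived subgroup of `G` for the other primes, and even by those of `G` if the order of `G` is
coprime to `q - 1`. -/
theorem commute_of_forall_quasinormal (hq : q.Prime) {P : Subgroup G} [hPn : P.Normal]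
    (hP : IsPGroup q P)
    (hquasi : ∀ M : Subgroup G, M ⋖ P → IsSQuasinormalFor IsSupersolubleGroup M) {r k : ℕ}
    (hr : r.Prime) (hrq : r ≠ q) {x : G} (hk : x ^ r ^ k = 1)
    (hx : x ∈ commutator G ∨ (Nat.card G).Coprime (q - 1)) {y : G} (hy : y ∈ P) :
    Commute x y := by
  obtain ⟨Φ, hΦn, hΦP, hgen, hsep⟩ := Subgroup.exists_frattini_of_isPGroup hq hP
  -- `D` is a smallest normal subgroup between `Φ` and `P` modulo which `x` centralizes `P`. If `D`
  -- were not `Φ`, a chief factor `D/D'` of order `q` would allow a further step down.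
  obtain ⟨D, ⟨hD, hΦD, hDP, hxD⟩, hDmin⟩ :=
    (Set.toFinite {D : Subgroup G | D.Normal ∧ Φ ≤ D ∧ D ≤ P ∧ ∀ y ∈ P, ⁅x, y⁆ ∈ D}).exists_minimal
      ⟨P, hPn, hΦP, le_rfl, fun y hy => Subgroup.commutator_le_right ⊤ P
        (Subgroup.commutator_mem_commutator (Subgroup.mem_top x) hy)⟩
  have hDΦ : D = Φ := by
    by_contra hne
    obtain ⟨D', ⟨hD', hΦD', hlt⟩, hmax⟩ :=
      (Set.toFinite {D' : Subgroup G | D'.Normal ∧ Φ ≤ D' ∧ D' < D}).exists_maximal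
        ⟨Φ, hΦn, le_rfl, lt_of_le_of_ne hΦD (Ne.symm hne)⟩
    have hchief : IsChiefFactor D D' := by
      refine ⟨hD, hD', hlt, fun N hN h1 h2 => ?_⟩
      rcases h2.eq_or_lt with e | e
      · exact Or.inr e
      · exact Or.inl (le_antisymm (hmax ⟨hN, hΦD'.trans h1, e⟩ h1) h1)
    have hprime := hchief.relIndex_prime_of_quasinormal hq hP hsep hquasi hΦD' hDP
    have hidx : D'.relIndex D = q := by
      have := Fact.mk hq
      obtain ⟨m, hm⟩ := IsPGroup.iff_card.1 (hP.to_le hDP)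
      have h2 : D'.relIndex D ∣ q ^ m := hm ▸ Subgroup.relIndex_dvd_card D' D
      exact (Nat.prime_dvd_prime_iff_eq hprime hq).1 (hprime.dvd_of_dvd_pow h2)
    have hD'mem : ∀ y ∈ P, ⁅x, y⁆ ∈ D' := fun y hy =>
      commutator_mem_of_series hq hr hrq (hP.to_le hDP) hk (hxD y hy)
        fun b hb => commutator_mem_of_relIndex_prime hprime (hidx.symm ▸ hx) hb
    exact hlt.not_ge (hDmin ⟨hD', hΦD', hlt.le.trans hDP, hD'mem⟩ hlt.le)
  subst hDΦ
  -- Coprime action gives `P = C_P(x) Φ(P)`, and the Frattini subgroup can be dropped from a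
  -- generating set.
  have h1 : P ≤ P ⊓ Subgroup.centralizer {x} ⊔ D := by
    intro y hy
    obtain ⟨b, hb, hc⟩ := exists_commute_of_commutator_mem hq hr hrq (hP.to_le hΦP) hk (hxD y hy)
    rw [← mul_inv_cancel_right y b]
    refine Subgroup.mul_mem_sup ⟨P.mul_mem hy (hΦP hb), ?_⟩ (D.inv_mem hb)
    exact Subgroup.mem_centralizer_singleton_iff.2 hc.eq.symm
  exact (Subgroup.mem_centralizer_singleton_iff.1 (hgen _ inf_le_left h1 hy).2).symm

end

/-! ### The characterization of `p`-nilpotency. -/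

theorem theorem4p4 {G : Type u} [Group G] [Finite G] (p : ℕ) (hp : p.Prime)
    (hpG : p ∣ Nat.card G) (hcop : (Nat.card G).Coprime (p - 1)) :
    IsPNilpotentGroup p G ↔
      ∃ (H : Subgroup G) (_ : H.Normal), Group.IsSolvable H ∧ IsPNilpotentGroup p (G ⧸ H) ∧
        ∀ (q : ℕ), q.Prime → ∀ P : Sylow q (fittingOf H),
          -- `M` ranges over the maximal subgroups of `P`, both seen as subgroups of `G`
          ∀ M : Subgroup G, M ⋖ (P : Subgroup (fittingOf H)).map (fittingOf H).subtype →
            IsSQuasinormalFor IsSupersolubleGroup M := by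
  constructor
  · intro h
    -- For `H = 1` the Fitting subgroup is trivial, so there are no maximal subgroups to test.
    refine ⟨⊥, inferInstance, inferInstance,
      h.of_mulEquiv (QuotientGroup.quotientBot (G := G)).symm, fun q _ P M hM => ?_⟩
    have h1 := (hM.lt.trans_le (Subgroup.map_subtype_le _)).trans_le (fittingOf_le ⊥)
    exact absurd h1 not_lt_bot
  · rintro ⟨H, hH, hs, hGH, hquasi⟩
    have hF := isNilpotent_fittingOf H
    have hcom : ∀ q r : ℕ, q.Prime → r.Prime → r ≠ q → ∀ x : G,
        (x ∈ commutator G ∨ (Nat.card G).Coprime (q - 1)) → (∃ k : ℕ, x ^ r ^ k = 1) →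
        ∀ y ∈ fittingOf H, (∃ k : ℕ, y ^ q ^ k = 1) → Commute x y := by
      rintro q r hq hr hrq x hx ⟨k, hk⟩ y hy ⟨l, hl⟩
      obtain ⟨P⟩ : Nonempty (Sylow q (fittingOf H)) := inferInstance
      obtain ⟨hPn, hPp, hPi⟩ := Subgroup.exists_normal_sylow hq hF P
      exact commute_of_forall_quasinormal hq hPp (hquasi q hq P) hr hrq hk hx
        (Subgroup.mem_of_pow_pow_eq_one hq hPi hy hl)
    -- `[G, H]` lies in `G'`, so its action on `F(H)` is controlled at every prime `q`, with no
    -- condition on `q - 1`.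
    have hE : ⁅(⊤ : Subgroup G), H⁆ ≤ fittingOf H := by
      refine le_fittingOf_of_commute hs _ inferInstance (Subgroup.commutator_le_right ⊤ H) ?_
      intro q r hq hr hrq x hx
      exact hcom q r hq hr hrq x (Or.inl (Subgroup.commutator_mono le_rfl le_top hx))
    have hGF : IsPNilpotentGroup p (G ⧸ fittingOf H) := by
      have hsurj := QuotientGroup.mk'_surjective (fittingOf H)
      let N := H.map (QuotientGroup.mk' (fittingOf H))
      have hN : N.Normal := hH.map _ hsurj
      have hcen : ∀ x : G ⧸ fittingOf H, ∀ y ∈ N, Commute x y := by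
        rintro x _ ⟨h, hh, rfl⟩
        obtain ⟨g, rfl⟩ := hsurj x
        rw [← commutatorElement_eq_one_iff_commute, ← map_commutatorElement]
        exact (QuotientGroup.eq_one_iff _).2
          (hE (Subgroup.commutator_mem_commutator (Subgroup.mem_top g) hh))
      have hNn : Group.IsNilpotent N := by
        -- `N = H/F(H)` is central, hence abelian, so the trivial subgroup already contains its
        -- derived subgroup.
        refine isNilpotent_of_commutator_le_nilpotent (F := ⊥) inferInstance ?_ ?_
        · rw [Subgroup.commutator_le]
          intro x _ y hy
          exact Subgroup.mem_bot.2 (commutatorElement_eq_one_iff_commute.2 (hcen x y hy))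
        · intro _ _ _ _ _ x _ _ y hy _
          rw [Subgroup.mem_bot.1 hy]
          exact Commute.one_right x
      obtain ⟨P⟩ : Nonempty (Sylow p N) := inferInstance
      obtain ⟨hPn, hPp, hPi⟩ := Subgroup.exists_normal_sylow hp hNn P
      have hPN := Subgroup.map_subtype_le (P : Subgroup N)
      exact IsPNilpotentGroup.of_quotient hp hPN hPp hPi (fun _ _ _ x _ y hy => hcen x y (hPN hy))
        (hGH.of_mulEquiv (QuotientGroup.quotientQuotientEquivQuotient _ H (fittingOf_le H)).symm)
    obtain ⟨P⟩ : Nonempty (Sylow p (fittingOf H)) := inferInstance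
    obtain ⟨hPn, hPp, hPi⟩ := Subgroup.exists_normal_sylow hp hF P
    have hPF := Subgroup.map_subtype_le (P : Subgroup (fittingOf H))
    -- Only here does the coprimality of `|G|` and `p - 1` enter: it gives the centralizing
    -- condition for all elements of `G` of prime power order prime to `p`, not just those of `G'`.
    exact IsPNilpotentGroup.of_quotient hp hPF hPp hPi (fun r hr hrp x hx y hy =>
      hcom p r hp hr hrp x (Or.inr hcop) hx y (hPF hy) (Subgroup.exists_pow_pow_eq_one hPp hy)) hGF
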